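/- Let $G=(V,E)$ be a finite directed acyclic graph, possibly with parallel edges, in which every edge has unit capacity, i.e. carries one symbol of a finite field $\mathbb F_q$. Let $s_1\ne s_2$ be two source nodes and let $t_1,t_2$ be terminal nodes with $\{s_1,s_2\}\cap\{t_1,t_2\}=\emptyset$. For $N_1,N_2\subseteq\{1,2\}$ let $k_{N_1-N_2}$ be the minimum cut between $\{s_i: i\in N_1\}$ and $\{t_j: j\in N_2\}$, i.e. the minimum, over all $W\subseteq V$ containing every $s_i$ with $i\in N_1$ and no $t_j$ with $j\in N_2$, of the number of edges from $W$ to $V\setminus W$; write $k_{12-1}$ for $k_{\{1,2\}-\{1\}}$, and so on. A pair $(R_1,R_2)$ of non-negative integers is achievable by linear codes if for some finite field $\mathbb F_q$ there are local coding coefficients $a_{ij,e}, f_{m,e}\in\mathbb F_q$ such that, when source $s_i$ emits an arbitrary vector $X_i\in\mathbb F_q^{R_i}$ ($i=1,2$) and the edge signals $Y_e$ are given by $$Y_e=\sum_{j=1}^{R_i}a_{ij,e}X_{ij}\ \text{ if } \mathrm{tail}(e)=s_i,\qquad Y_e=\sum_{m:\ \mathrm{head}(m)=\mathrm{tail}(e)}f_{m,e}Y_m\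 \text{ if } \mathrm{tail}(e)\notin\{s_1,s_2\},$$ each terminal $t_i$ ($i=1,2$) can determine $X_i$ from the signals on its incoming edges. Theorem (low interference). Suppose $k_{1-2}+k_{2-1}\le\min(k_{12-1},k_{12-2})$. Then every pair $(R_1,R_2)$ of non-negative integers with $$R_1\le k_{12-1}-k_{2-1},\qquad R_2\le k_{12-2}-k_{1-2}$$ is achievable by linear codes. -/

import Mathlib

/-- A directed acyclic multigraph with node set `V` and unit-capacity edges `E`
(parallel edges are allowed), carrying two unicast sessions `s i → t i`, `i : Fin 2`. -/
structure TwoUnicastNetwork (V E : Type*) where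
  tail : E → V
  head : E → V
  /-- There is no directed cycle. -/
  acyclic : ∀ v, ¬ Relation.TransGen (fun u w => ∃ e, tail e = u ∧ head e = w) v v
  s : Fin 2 → V
  t : Fin 2 → V
  s_injective : Function.Injective s
  s_ne_t : ∀ i j, s i ≠ t j

namespace TwoUnicastNetwork

variable {V E : Type*}

/-- The minimum cut `k_{A-B}` between the sources with index in `A` and the terminals with index
in `B`: the least number of edges leaving a node set `W` that contains all these sources and
none of these terminals. -/
noncomputable def minCut (G : TwoUnicastNetwork V E) (A B : Set (Fin 2)) : ℕ :=
  sInf {n | ∃ W : Set V, (∀ i ∈ A, G.s i ∈ W) ∧ (∀ j ∈ B, G.t j ∉ W) ∧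
    n = {e : E | G.tail e ∈ W ∧ G.head e ∉ W}.ncard}

/-- The local coding coefficients over `F` of a linear network code at rates `R`: `a i j e` is the
coefficient of the `j`-th symbol of source `i` on an edge `e` leaving that source, and `f m e` the
coefficient of the signal of `m` on an edge `e` whose tail is the head of `m`. -/
structure LinearCode (E F : Type*) (R : Fin 2 → ℕ) where
  a : (i : Fin 2) → Fin (R i) → E → F
  f : E → E → F

open scoped Classical in
/-- `Y` are the signals on the edges when the code `c` is used and source `i` emits `X i`. -/
def IsSignal [Fintype E] (G : TwoUnicastNetwork V E) {F : Type*} [Field F] {R : Fin 2 → ℕ}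
    (c : LinearCode E F R) (X : (i : Fin 2) → Fin (R i) → F) (Y : E → F) : Prop :=
  (∀ e i, G.tail e = G.s i → Y e = ∑ j, c.a i j e * X i j) ∧
  (∀ e, (∀ i, G.tail e ≠ G.s i) →
    Y e = ∑ m ∈ Finset.univ.filter (fun m => G.head m = G.tail e), c.f m e * Y m)

/-- The rate pair `R` is achievable by a scalar linear network code over some finite field:
the code transmits every pair of messages, and each terminal `t i` recovers the message of `s i`
from the signals on its incoming edges. -/
def Achievable [Fintype E] (G : TwoUnicastNetwork V E) (R : Fin 2 → ℕ) : Prop :=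
  ∃ (F : Type) (_ : Field F) (_ : Finite F) (c : LinearCode E F R)
    (Y : ((i : Fin 2) → Fin (R i) → F) → E → F),
    (∀ X, G.IsSignal c X (Y X)) ∧
    ∀ i, ∃ D : ({e : E // G.head e = G.t i} → F) → (Fin (R i) → F),
      ∀ X, D (fun e => Y X e.1) = X i

end TwoUnicastNetwork

/-! Let each edge leaving a source carry its own free symbol, and code generically inside the
network. The signals entering `t i` then have rank at least the cut from both sources, since
genericity turns a suitable cut into independent encoding vectors (`exists_cut_le_finrank_span`).
Whatever the other source `s k` sends reaches `t i` in a space of dimension at most `minCut {k} {i}`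
(`finrank_map_sourceSpace_le_minCut`). Modulo this interference, source `i` still spans dimension at
least the difference of the two cuts, hence at least `R i`. It precodes its message along `R i`
vectors independent modulo the interference (`exists_independent_modulo`), and `t i` decodes. -/

open Module

/-! ### Linear algebra: generic vectors and independence modulo a subspace -/

section LinearAlgebra

variable {F M N : Type*} [Field F] [AddCommGroup M] [Module F M] [AddCommGroup N] [Module F N]

/-- Over a large field, a subspace `S` contains a vector that lies in a given finite collection of
subspaces only where `S` is forced to. -/
theorem Submodule.exists_mem_forall_mem_imp_le {ι : Type*} [Fintype ι] (S : Submodule F M)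
    (p : ι → Submodule F M) (h : (Fintype.card ι : ℕ∞) < ENat.card F) :
    ∃ x ∈ S, ∀ i, x ∈ p i → S ≤ p i := by
  classical
  let q : {i // ¬ S ≤ p i} → Submodule F S := fun i => (p i).comap S.subtype
  have hq : ∀ i, q i ≠ ⊤ := fun i hi => i.2 (Submodule.comap_subtype_eq_top.mp hi)
  have hcard : ((Finset.univ : Finset {i // ¬ S ≤ p i}).card : ℕ∞) < ENat.card F :=
    lt_of_le_of_lt (by exact_mod_cast Fintype.card_subtype_le _) h
  have hlt := Submodule.iUnion_ssubset_of_forall_ne_top_of_card_lt Finset.univ q hq hcard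
  obtain ⟨x, -, hx⟩ := Set.exists_of_ssubset hlt
  refine ⟨x, x.2, fun i hi => ?_⟩
  by_contra hS
  exact hx (Set.mem_iUnion₂.mpr ⟨⟨i, hS⟩, Finset.mem_univ _, hi⟩)

/-- Genericity speaks only of spans of earlier edges, so independence is tested along the order. -/
theorem linearIndepOn_of_forall_notMem_span_lt {ι : Type*} [LinearOrder ι] (f : ι → M)
    (s : Finset ι) (h : ∀ e ∈ s, f e ∉ Submodule.span F (f '' {b | b ∈ s ∧ b < e})) :
    LinearIndepOn F f (s : Set ι) := by
  induction s using Finset.induction_on_max with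
  | empty => simp
  | insert a s ha ih =>
    have hs : {b | b ∈ insert a s ∧ b < a} = (s : Set ι) := by
      ext b
      simp only [Finset.mem_insert, Set.mem_ofPred_eq, Finset.mem_coe]
      constructor
      · rintro ⟨rfl | hb, hlt⟩
        · exact absurd hlt (lt_irrefl _)
        · exact hb
      · exact fun hb => ⟨Or.inr hb, ha b hb⟩
    rw [Finset.coe_insert]
    refine LinearIndepOn.insert (ih fun e he hmem => h e (Finset.mem_insert_of_mem he) ?_) ?_
    · refine Submodule.span_mono (Set.image_mono ?_) hmem
      exact fun b hb => ⟨Finset.mem_insert_of_mem hb.1, hb.2⟩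
    · have := h a (Finset.mem_insert_self a s)
      rwa [hs] at this

/-- A linear map with large rank admits vectors in `A` whose images are linearly independent
modulo the image of `B`. -/
theorem LinearMap.exists_independent_modulo [FiniteDimensional F N] (L : M →ₗ[F] N)
    (A B : Submodule F M) (r : ℕ) (hAB : LinearMap.range L ≤ A.map L ⊔ B.map L)
    (hr : finrank F (B.map L) + r ≤ finrank F (LinearMap.range L)) :
    ∃ v : Fin r → M, (∀ j, v j ∈ A) ∧
      ∀ c : Fin r → F, ∀ b ∈ B, L (∑ j, c j • v j + b) = 0 → c = 0 := by
  let Q := (B.map L).mkQ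
  have hrange : (LinearMap.range L).map Q ≤ (A.map L).map Q := by
    refine (Submodule.map_mono hAB).trans ?_
    rw [Submodule.map_sup, sup_le_iff]
    refine ⟨le_rfl, ?_⟩
    rw [Submodule.mkQ_map_self]
    exact bot_le
  have hrank : r ≤ finrank F ((A.map L).map Q) := by
    -- Rank-nullity on the range of `L`: passing to the quotient loses at most the dimension of
    -- `B.map L`.
    have h1 := LinearMap.finrank_range_add_finrank_ker (Q ∘ₗ (LinearMap.range L).subtype)
    have h2 : finrank F (LinearMap.ker (Q ∘ₗ (LinearMap.range L).subtype))
        ≤ finrank F (B.map L) := by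
      rw [LinearMap.ker_comp, Submodule.ker_mkQ, ← Submodule.finrank_map_subtype_eq,
        Submodule.map_comap_subtype]
      exact Submodule.finrank_mono inf_le_right
    have h3 : finrank F (LinearMap.range (Q ∘ₗ (LinearMap.range L).subtype))
        ≤ finrank F ((A.map L).map Q) := by
      rw [LinearMap.range_comp, Submodule.range_subtype]
      exact Submodule.finrank_mono hrange
    omega
  obtain ⟨w, hw⟩ := exists_linearIndependent_of_le_finrank hrank
  have hpre : ∀ j, ∃ v ∈ A, Q (L v) = w j := by
    intro j
    obtain ⟨y, ⟨v, hv, rfl⟩, hy⟩ := (w j).2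
    exact ⟨v, hv, hy⟩
  choose v hvA hvw using hpre
  refine ⟨v, hvA, fun c b hb h0 => ?_⟩
  have hb0 : Q (L b) = 0 := (Submodule.Quotient.mk_eq_zero _).mpr ⟨b, hb, rfl⟩
  have h1 : ∑ j, c j • w j = 0 := by
    apply Subtype.ext
    have := congrArg Q h0
    simp only [map_add, map_sum, map_smul, hb0, hvw, add_zero, map_zero] at this
    simpa using this
  exact funext (Fintype.linearIndependent_iff.mp hw c h1)

end LinearAlgebra

/-- Successive choice along a finite linear order. -/
theorem exists_forall_of_forall_exists_lt {ι X : Type*} [LinearOrder ι] [Finite ι] [Nonempty X]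
    (P : ι → (ι → X) → X → Prop)
    (hP : ∀ e g g' x, (∀ b < e, g b = g' b) → P e g x → P e g' x)
    (hex : ∀ e g, ∃ x, P e g x) : ∃ g : ι → X, ∀ e, P e g (g e) := by
  have := Fintype.ofFinite ι
  suffices h : ∀ s : Finset ι, ∃ g : ι → X, ∀ e ∈ s, P e g (g e) by
    obtain ⟨g, hg⟩ := h Finset.univ
    exact ⟨g, fun e => hg e (Finset.mem_univ e)⟩
  intro s
  induction s using Finset.induction_on_max with
  | empty => exact ⟨fun _ => Classical.arbitrary X, by simp⟩
  | insert a s ha ih =>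
    obtain ⟨g, hg⟩ := ih
    obtain ⟨x, hx⟩ := hex a g
    refine ⟨Function.update g a x, fun e he => ?_⟩
    rcases Finset.mem_insert.mp he with rfl | he
    · rw [Function.update_self]
      exact hP e g _ x (fun b hb => (Function.update_of_ne hb.ne _ _).symm) hx
    · rw [Function.update_of_ne (ha e he).ne]
      exact hP e g _ _ (fun b hb =>
        (Function.update_of_ne (hb.trans (ha e he)).ne _ _).symm) (hg e he)

/-! ### Edge ordering and generic encodings -/

namespace TwoUnicastNetwork

variable {V E : Type*}

/-- Acyclicity makes reachability between edges antisymmetric; any linear extension works. -/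
theorem exists_topological_linearOrder (G : TwoUnicastNetwork V E) :
    ∃ _ : LinearOrder E, ∀ m e, G.head m = G.tail e → m < e := by
  let r : E → E → Prop := fun m e => G.head m = G.tail e
  let adj : V → V → Prop := fun u w => ∃ e, G.tail e = u ∧ G.head e = w
  have hr : ∀ m e : E, Relation.TransGen r m e → Relation.TransGen adj (G.tail m) (G.tail e) := by
    intro m e h
    exact h.lift G.tail fun a b hab => ⟨a, rfl, hab⟩
  have hirr : ∀ e, ¬ Relation.TransGen r e e := fun e h => G.acyclic _ (hr e e h)
  let P : PartialOrder E :=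
    { le := Relation.ReflTransGen r
      le_refl := fun _ => Relation.ReflTransGen.refl
      le_trans := fun _ _ _ => Relation.ReflTransGen.trans
      le_antisymm := by
        intro a b hab hba
        rcases Relation.reflTransGen_iff_eq_or_transGen.mp hab with h | h
        · exact h.symm
        · exact absurd (h.trans_left hba) (hirr a) }
  refine ⟨(inferInstance : LinearOrder (LinearExtension E)), fun m e h => ?_⟩
  refine lt_of_le_of_ne (α := LinearExtension E)
    (toLinearExtension.monotone' (Relation.ReflTransGen.single h)) ?_
  rintro rfl
  exact hirr _ (Relation.TransGen.single h)

open scoped Classical in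
/-- `f` are the global encoding vectors of the code with inner coefficients `φ` in which every edge
leaving a source carries its own symbol; every other edge lies in the span of earlier edges only
if all edges entering its tail do. -/
structure IsGenericEncoding [Fintype E] [LinearOrder E] (G : TwoUnicastNetwork V E)
    {F : Type*} [Field F] (φ f : E → E → F) : Prop where
  source : ∀ e i, G.tail e = G.s i → f e = Pi.single e 1
  inner : ∀ e, (∀ i, G.tail e ≠ G.s i) → f e = ∑ m with G.head m = G.tail e, φ m e • f m
  generic : ∀ e, (∀ i, G.tail e ≠ G.s i) → ∀ B : Set E, (∀ b ∈ B, b < e) →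
    f e ∈ Submodule.span F (f '' B) → ∀ m, G.head m = G.tail e → f m ∈ Submodule.span F (f '' B)

/-- The vectors are chosen in edge order. The sets `B` give at most `2 ^ card E` subspaces to avoid,
too few to cover the span of the inputs over so large a field. -/
theorem exists_isGenericEncoding [Fintype E] [LinearOrder E] (G : TwoUnicastNetwork V E)
    (hlt : ∀ m e, G.head m = G.tail e → m < e) (F : Type*) [Field F]
    (hF : ((2 ^ Fintype.card E : ℕ) : ℕ∞) < ENat.card F) :
    ∃ φ f : E → E → F, G.IsGenericEncoding φ f := by
  classical
  let P : E → (E → E → F) → (E → F) → Prop := fun e g x =>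
    (∀ i, G.tail e = G.s i → x = Pi.single e 1) ∧
    ((∀ i, G.tail e ≠ G.s i) →
      x ∈ Submodule.span F (g '' {m | G.head m = G.tail e}) ∧
      ∀ B : Set E, (∀ b ∈ B, b < e) → x ∈ Submodule.span F (g '' B) →
        Submodule.span F (g '' {m | G.head m = G.tail e}) ≤ Submodule.span F (g '' B))
  obtain ⟨f, hf⟩ : ∃ f : E → E → F, ∀ e, P e f (f e) := by
    refine exists_forall_of_forall_exists_lt P ?_ ?_
    · rintro e g g' x hgg ⟨hs, hi⟩
      have himg : ∀ B : Set E, (∀ b ∈ B, b < e) → g' '' B = g '' B := fun B hB =>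
        Set.image_congr fun b hb => (hgg b (hB b hb)).symm
      refine ⟨hs, fun he => ?_⟩
      rw [himg {m | G.head m = G.tail e} fun m hm => hlt m e hm]
      refine ⟨(hi he).1, fun B hB => ?_⟩
      rw [himg B hB]
      exact (hi he).2 B hB
    · intro e g
      by_cases hs : ∃ i, G.tail e = G.s i
      · exact ⟨Pi.single e 1, fun _ _ => rfl, fun h => absurd hs (by simpa using h)⟩
      · push Not at hs
        obtain ⟨x, hx, hxB⟩ := Submodule.exists_mem_forall_mem_imp_le
          (Submodule.span F (g '' {m | G.head m = G.tail e}))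
          (fun B : Set E => Submodule.span F (g '' B)) (by rwa [Fintype.card_set])
        exact ⟨x, fun i hi => absurd hi (hs i), fun _ => ⟨hx, fun B _ => hxB B⟩⟩
  have hcoef : ∀ e, ∃ c : E → F, (∀ i, G.tail e ≠ G.s i) →
      f e = ∑ m with G.head m = G.tail e, c m • f m := by
    intro e
    by_cases hs : ∀ i, G.tail e ≠ G.s i
    · have hmem := ((hf e).2 hs).1
      have hset : {m | G.head m = G.tail e} =
          ((Finset.univ.filter fun m => G.head m = G.tail e : Finset E) : Set E) := by simp
      rw [hset, Submodule.mem_span_image_finset_iff_exists_fun'] at hmem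
      obtain ⟨c, hc⟩ := hmem
      exact ⟨c, fun _ => hc.symm⟩
    · exact ⟨0, fun h => absurd h hs⟩
  choose c hc using hcoef
  refine ⟨fun m e => c e m, f, fun e i he => (hf e).1 i he, hc, fun e he B hB hmem m hm => ?_⟩
  exact ((hf e).2 he).2 B hB hmem (Submodule.subset_span ⟨m, hm, rfl⟩)

/-! ### Rank of a generic encoding and cuts -/

namespace IsGenericEncoding

variable [Fintype E] [LinearOrder E] {G : TwoUnicastNetwork V E} {F : Type*} [Field F]
  {φ f : E → E → F}

theorem eq_zero_of_lt (h : G.IsGenericEncoding φ f) (hlt : ∀ m e, G.head m = G.tail e → m < e)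
    (e : E) : ∀ c, e < c → f e c = 0 := by
  classical
  induction e using WellFoundedLT.induction with
  | ind e ih =>
    intro c hc
    by_cases hs : ∃ i, G.tail e = G.s i
    · obtain ⟨i, hi⟩ := hs
      rw [h.source e i hi, Pi.single_eq_of_ne hc.ne']
    · push Not at hs
      rw [h.inner e hs, Finset.sum_apply]
      refine Finset.sum_eq_zero fun m hm => ?_
      have hme := hlt m e (Finset.mem_filter.mp hm).2
      simp [ih m hme c (hme.trans hc)]

theorem eq_zero_of_not_source (h : G.IsGenericEncoding φ f)
    (hlt : ∀ m e, G.head m = G.tail e → m < e) (e : E) :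
    ∀ c, (∀ i, G.tail c ≠ G.s i) → f e c = 0 := by
  classical
  induction e using WellFoundedLT.induction with
  | ind e ih =>
    intro c hc
    by_cases hs : ∃ i, G.tail e = G.s i
    · obtain ⟨i, hi⟩ := hs
      rw [h.source e i hi, Pi.single_eq_of_ne]
      rintro rfl
      exact hc i hi
    · push Not at hs
      rw [h.inner e hs, Finset.sum_apply]
      refine Finset.sum_eq_zero fun m hm => ?_
      simp [ih m (hlt m e (Finset.mem_filter.mp hm).2) c hc]

/-- Coordinate `e` vanishes on all earlier vectors but equals one on `f e`. -/
theorem source_notMem_span (h : G.IsGenericEncoding φ f)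
    (hlt : ∀ m e, G.head m = G.tail e → m < e) {e : E} {i : Fin 2} (he : G.tail e = G.s i)
    (B : Set E) (hB : ∀ b ∈ B, b < e) : f e ∉ Submodule.span F (f '' B) := by
  intro hmem
  have hle : Submodule.span F (f '' B) ≤
      LinearMap.ker (LinearMap.proj (R := F) (φ := fun _ => F) e) := by
    rw [Submodule.span_le]
    rintro _ ⟨b, hb, rfl⟩
    exact h.eq_zero_of_lt hlt b e (hB b hb)
  have h0 : f e e = 0 := hle hmem
  rw [h.source e i he, Pi.single_eq_same] at h0
  exact one_ne_zero h0

/-- The encoding vectors entering a non-source node span a space at least as large as the minimum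
cut between the sources and that node. -/
theorem exists_cut_le_finrank_span (h : G.IsGenericEncoding φ f)
    (hlt : ∀ m e, G.head m = G.tail e → m < e) (t : V) (ht : ∀ i, G.s i ≠ t) :
    ∃ W : Set V, (∀ i, G.s i ∈ W) ∧ t ∉ W ∧
      {e : E | G.tail e ∈ W ∧ G.head e ∉ W}.ncard ≤
        finrank F (Submodule.span F (f '' {e | G.head e = t})) := by
  classical
  set U := Submodule.span F (f '' {e | G.head e = t}) with hU
  -- With this `W`, every edge leaving it has its vector in `U`.
  let W : Set V := {v | (∃ i, G.s i = v) ∨ ∃ e, G.head e = v ∧ f e ∉ U}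
  refine ⟨W, fun i => Or.inl ⟨i, rfl⟩, ?_, ?_⟩
  · rintro (⟨i, hi⟩ | ⟨e, he, heU⟩)
    · exact ht i hi
    · exact heU (Submodule.subset_span ⟨e, he, rfl⟩)
  · let A : Finset E := {e | G.tail e ∈ W ∧ G.head e ∉ W}
    have hAU : ∀ e ∈ A, f e ∈ U := by
      intro e he
      by_contra heU
      exact (Finset.mem_filter.mp he).2.2 (Or.inr ⟨e, rfl, heU⟩)
    have hind : LinearIndepOn F f (A : Set E) := by
      refine linearIndepOn_of_forall_notMem_span_lt f A fun e he hmem => ?_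
      by_cases hs : ∃ i, G.tail e = G.s i
      · obtain ⟨i, hi⟩ := hs
        exact h.source_notMem_span hlt hi _ (fun b hb => hb.2) hmem
      · push Not at hs
        obtain ⟨i, hi⟩ | ⟨m, hm, hmU⟩ := (Finset.mem_filter.mp he).2.1
        · exact hs i hi.symm
        · refine hmU (?_ : f m ∈ U)
          -- A dependence at `e` would pull `f m` into the span of earlier cut edges, hence into
          -- `U`.
          have hm' := h.generic e hs _ (fun b hb => hb.2) hmem m hm
          refine Submodule.span_le.mpr ?_ hm'
          rintro _ ⟨b, hb, rfl⟩
          exact hAU b hb.1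
    have hcard : {e : E | G.tail e ∈ W ∧ G.head e ∉ W}.ncard = A.card := by
      rw [← Set.ncard_coe_finset]
      simp [A]
    have hfin := finrank_span_eq_card hind
    rw [hcard, ← Fintype.card_coe A]
    refine hfin.symm.le.trans (Submodule.finrank_mono (Submodule.span_le.mpr ?_))
    rintro _ ⟨b, rfl⟩
    exact hAU b b.2

end IsGenericEncoding

/-! ### Transfer maps, interference and precoding -/

/-- The signals received at `v` as a function of the symbols on the edges leaving the sources. -/
def transfer [Fintype E] (G : TwoUnicastNetwork V E) {F : Type*} [Field F] (f : E → E → F) (v : V) :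
    (E → F) →ₗ[F] ({e : E // G.head e = v} → F) :=
  Matrix.mulVecLin (Matrix.of fun e => f e.1)

theorem transfer_apply [Fintype E] (G : TwoUnicastNetwork V E) {F : Type*} [Field F]
    (f : E → E → F) (v : V) (x : E → F) (e : {e : E // G.head e = v}) :
    G.transfer f v x e = f e.1 ⬝ᵥ x := rfl

theorem finrank_range_transfer [Fintype E] (G : TwoUnicastNetwork V E) {F : Type*} [Field F]
    (f : E → E → F) (v : V) : finrank F (LinearMap.range (G.transfer f v)) =
      finrank F (Submodule.span F (f '' {e | G.head e = v})) := by
  have h := Matrix.rank_eq_finrank_span_row (Matrix.of fun e : {e : E // G.head e = v} => f e.1)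
  have hr : Set.range (Matrix.of fun e : {e : E // G.head e = v} => f e.1).row =
      f '' {e | G.head e = v} := by
    ext x
    constructor
    · rintro ⟨e, rfl⟩
      exact ⟨e.1, e.2, rfl⟩
    · rintro ⟨e, he, rfl⟩
      exact ⟨⟨e, he⟩, rfl⟩
  rw [hr] at h
  exact h

/-- The symbol vectors that vanish outside the edges leaving source `i`. -/
def sourceSpace (G : TwoUnicastNetwork V E) (F : Type*) [Field F] (i : Fin 2) :
    Submodule F (E → F) where
  carrier := {x | ∀ e, G.tail e ≠ G.s i → x e = 0}
  zero_mem' := fun _ _ => rfl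
  add_mem' := fun hx hy e he => by simp [hx e he, hy e he]
  smul_mem' := fun c x hx e he => by simp [hx e he]

namespace IsGenericEncoding

variable [Fintype E] [LinearOrder E] {G : TwoUnicastNetwork V E} {F : Type*} [Field F]
  {φ f : E → E → F}

theorem dotProduct_source (h : G.IsGenericEncoding φ f) {e : E} {i : Fin 2}
    (he : G.tail e = G.s i) (x : E → F) : f e ⬝ᵥ x = x e := by
  rw [h.source e i he, single_one_dotProduct]

open scoped Classical in
theorem dotProduct_inner (h : G.IsGenericEncoding φ f) {e : E} (he : ∀ i, G.tail e ≠ G.s i)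
    (x : E → F) : f e ⬝ᵥ x = ∑ m with G.head m = G.tail e, φ m e * (f m ⬝ᵥ x) := by
  conv_lhs => rw [h.inner e he]
  simp [sum_dotProduct, smul_dotProduct]

theorem minCut_le_finrank_range (h : G.IsGenericEncoding φ f)
    (hlt : ∀ m e, G.head m = G.tail e → m < e) (j : Fin 2) :
    G.minCut {0, 1} {j} ≤ finrank F (LinearMap.range (G.transfer f (G.t j))) := by
  obtain ⟨W, hs, ht, hle⟩ := h.exists_cut_le_finrank_span hlt (G.t j) (fun i => G.s_ne_t i j)
  rw [G.finrank_range_transfer]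
  refine le_trans (Nat.sInf_le ?_) hle
  refine ⟨W, fun i _ => hs i, ?_, rfl⟩
  rintro _ rfl
  exact ht

theorem range_transfer_le (h : G.IsGenericEncoding φ f)
    (hlt : ∀ m e, G.head m = G.tail e → m < e) (v : V) {i k : Fin 2} (hik : i ≠ k) :
    LinearMap.range (G.transfer f v) ≤
      (G.sourceSpace F i).map (G.transfer f v) ⊔ (G.sourceSpace F k).map (G.transfer f v) := by
  classical
  rintro _ ⟨x, rfl⟩
  let y : Fin 2 → E → F := fun l e => if G.tail e = G.s l then x e else 0
  have hy : ∀ l, y l ∈ G.sourceSpace F l := fun l e he => if_neg he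
  have hx : G.transfer f v x = G.transfer f v (y i) + G.transfer f v (y k) := by
    rw [← map_add]
    funext e
    rw [transfer_apply, transfer_apply]
    refine Finset.sum_congr rfl fun c _ => ?_
    by_cases hc : ∃ l, G.tail c = G.s l
    · obtain ⟨l, hl⟩ := hc
      have hl' : l = i ∨ l = k := by omega
      rcases hl' with rfl | rfl
      · simp [y, hl, G.s_injective.ne hik]
      · simp [y, hl, G.s_injective.ne hik.symm]
    · push Not at hc
      rw [h.eq_zero_of_not_source hlt e c hc, zero_mul, zero_mul]
  rw [hx]
  exact Submodule.add_mem_sup ⟨_, hy i, rfl⟩ ⟨_, hy k, rfl⟩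

/-- If a source transmits nothing across a cut, nothing it transmits arrives beyond the cut. -/
theorem dotProduct_eq_zero_of_cut (h : G.IsGenericEncoding φ f)
    (hlt : ∀ m e, G.head m = G.tail e → m < e) {k : Fin 2} {W : Set V} (hk : G.s k ∈ W)
    {x : E → F} (hx : x ∈ G.sourceSpace F k)
    (hcut : ∀ e, G.tail e ∈ W → G.head e ∉ W → f e ⬝ᵥ x = 0) (e : E) :
    G.head e ∉ W → f e ⬝ᵥ x = 0 := by
  classical
  induction e using WellFoundedLT.induction with
  | ind e ih =>
    intro he
    by_cases htail : G.tail e ∈ W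
    · exact hcut e htail he
    · by_cases hs : ∃ i, G.tail e = G.s i
      · obtain ⟨i, hi⟩ := hs
        rw [h.dotProduct_source hi]
        refine hx e fun hek => htail ?_
        rwa [hek]
      · push Not at hs
        rw [h.dotProduct_inner hs]
        refine Finset.sum_eq_zero fun m hm => ?_
        have hm := (Finset.mem_filter.mp hm).2
        rw [ih m (hlt m e hm) (by rwa [hm]), mul_zero]

/-- The signals on a minimum cut determine what arrives at `t j`, so the rank is at most the number
of cut edges. -/
theorem finrank_map_sourceSpace_le_minCut (h : G.IsGenericEncoding φ f)
    (hlt : ∀ m e, G.head m = G.tail e → m < e) (k j : Fin 2) :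
    finrank F ((G.sourceSpace F k).map (G.transfer f (G.t j))) ≤ G.minCut {k} {j} := by
  classical
  have hne : {n | ∃ W : Set V, (∀ i ∈ ({k} : Set (Fin 2)), G.s i ∈ W) ∧
      (∀ i ∈ ({j} : Set (Fin 2)), G.t i ∉ W) ∧
      n = {e : E | G.tail e ∈ W ∧ G.head e ∉ W}.ncard}.Nonempty := by
    refine ⟨_, {G.s k}, ?_, ?_, rfl⟩
    · rintro _ rfl
      rfl
    · rintro _ rfl hmem
      exact G.s_ne_t _ _ hmem.symm
  obtain ⟨W, hs, ht, hn⟩ := Nat.sInf_mem hne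
  rw [minCut, hn]
  let A : Set E := {e : E | G.tail e ∈ W ∧ G.head e ∉ W}
  let C : (E → F) →ₗ[F] (A → F) := Matrix.mulVecLin (Matrix.of fun e : A => f e.1)
  let L₁ := (G.transfer f (G.t j)).domRestrict (G.sourceSpace F k)
  let C₁ := C.domRestrict (G.sourceSpace F k)
  have hker : LinearMap.ker C₁ ≤ LinearMap.ker L₁ := by
    intro x hx
    refine LinearMap.mem_ker.mpr (funext fun e => ?_)
    refine h.dotProduct_eq_zero_of_cut hlt (hs k rfl) x.2 (fun c hc hc' => ?_) e.1
      (by rw [e.2]; exact ht j rfl)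
    exact congrFun (LinearMap.mem_ker.mp hx) ⟨c, hc, hc'⟩
  have h1 := LinearMap.finrank_range_add_finrank_ker L₁
  have h2 := LinearMap.finrank_range_add_finrank_ker C₁
  have h3 := Submodule.finrank_mono hker
  have h4 : finrank F (LinearMap.range C₁) ≤ A.ncard := by
    refine (Submodule.finrank_le _).trans ?_
    rw [finrank_fintype_fun_eq_card, Set.ncard_eq_toFinset_card', Set.toFinset_card]
  have h5 : LinearMap.range L₁ = (G.sourceSpace F k).map (G.transfer f (G.t j)) :=
    LinearMap.range_domRestrict _ _
  rw [h5] at h1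
  change _ ≤ A.ncard
  omega

end IsGenericEncoding

/-- Precoding at the sources that keeps each session's message apart from the interference turns
a generic encoding into a code that achieves the rates `R`. -/
theorem IsGenericEncoding.achievable [Fintype E] [LinearOrder E] {G : TwoUnicastNetwork V E}
    {F : Type} [Field F] [Finite F] {φ f : E → E → F} (h : G.IsGenericEncoding φ f)
    (hlt : ∀ m e, G.head m = G.tail e → m < e) (R : Fin 2 → ℕ)
    (hR : ∀ i k, i ≠ k → G.minCut {k} {i} + R i ≤ G.minCut {0, 1} {i}) : G.Achievable R := by
  classical
  have hv : ∀ i, ∃ v : Fin (R i) → E → F, (∀ j, v j ∈ G.sourceSpace F i) ∧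
      ∀ k, i ≠ k → ∀ c : Fin (R i) → F, ∀ b ∈ G.sourceSpace F k,
        G.transfer f (G.t i) (∑ j, c j • v j + b) = 0 → c = 0 := by
    intro i
    obtain ⟨k, hk⟩ := exists_ne i
    -- Independence is modulo everything source `k` could send, so the two precoders are chosen
    -- separately.
    obtain ⟨v, hvA, hv⟩ := (G.transfer f (G.t i)).exists_independent_modulo (G.sourceSpace F i)
      (G.sourceSpace F k) (R i) (h.range_transfer_le hlt _ hk.symm) (by
        have h1 := h.finrank_map_sourceSpace_le_minCut hlt k i
        have h2 := h.minCut_le_finrank_range hlt i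
        have h3 := hR i k hk.symm
        omega)
    refine ⟨v, hvA, fun k' hk' => ?_⟩
    obtain rfl : k' = k := by omega
    exact hv
  choose v hvA hv using hv
  let x : ((i : Fin 2) → Fin (R i) → F) →ₗ[F] (E → F) :=
    ∑ i, (Fintype.linearCombination F (v i)) ∘ₗ LinearMap.proj i
  have hx : ∀ X, x X = ∑ i, ∑ j, X i j • v i j := by
    intro X
    simp [x, Fintype.linearCombination_apply]
  refine ⟨F, inferInstance, inferInstance, ⟨fun i j e => v i j e, φ⟩, fun X e => f e ⬝ᵥ x X,
    fun X => ⟨fun e i he => ?_, fun e he => ?_⟩, fun i => ?_⟩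
  · change f e ⬝ᵥ x X = ∑ j, v i j e * X i j
    rw [h.dotProduct_source he, hx, Finset.sum_apply, Finset.sum_eq_single i]
    · simp [Finset.sum_apply, mul_comm]
    · intro k _ hk
      rw [Finset.sum_apply]
      refine Finset.sum_eq_zero fun j _ => ?_
      have : v k j e = 0 := hvA k j e (by rw [he]; exact G.s_injective.ne hk.symm)
      simp [this]
    · simp
  · exact h.dotProduct_inner he _
  · have hinj : ∀ X X', G.transfer f (G.t i) (x X) = G.transfer f (G.t i) (x X') →
        X i = X' i := by
      intro X X' hXX'
      obtain ⟨k, hk⟩ := exists_ne i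
      have huniv : (Finset.univ : Finset (Fin 2)) = {i, k} := by
        ext l
        simp only [Finset.mem_univ, Finset.mem_insert, Finset.mem_singleton, true_iff]
        omega
      have h0 : G.transfer f (G.t i) (x (X - X')) = 0 := by
        rw [map_sub, map_sub, hXX', sub_self]
      rw [hx, huniv, Finset.sum_pair hk.symm] at h0
      refine sub_eq_zero.mp (hv i k hk.symm _ _ ?_ h0)
      exact Submodule.sum_mem _ fun j _ => Submodule.smul_mem _ _ (hvA k j)
    let T : ((l : Fin 2) → Fin (R l) → F) → {e : E // G.head e = G.t i} → F :=
      fun X => G.transfer f (G.t i) (x X)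
    -- Any message pair explaining the received signals has the right component `i`, though the
    -- other component may differ.
    refine ⟨fun y => Function.invFun T y i, fun X => hinj _ _ ?_⟩
    exact Function.invFun_eq (f := T) ⟨X, rfl⟩

end TwoUnicastNetwork

theorem mainTheorem1 {V E : Type*} [Finite V] [Fintype E] (G : TwoUnicastNetwork V E)
    (hlow : G.minCut {0} {1} + G.minCut {1} {0} ≤
      min (G.minCut {0, 1} {0}) (G.minCut {0, 1} {1}))
    (R : Fin 2 → ℕ)
    (h₁ : (R 0 : ℤ) ≤ (G.minCut {0, 1} {0} : ℤ) - (G.minCut {1} {0} : ℤ))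
    (h₂ : (R 1 : ℤ) ≤ (G.minCut {0, 1} {1} : ℤ) - (G.minCut {0} {1} : ℤ)) :
    G.Achievable R := by
  obtain ⟨_, hlt⟩ := G.exists_topological_linearOrder
  obtain ⟨p, hp, hprime⟩ := Nat.exists_infinite_primes (2 ^ Fintype.card E + 1)
  have := Fact.mk hprime
  have hF : ((2 ^ Fintype.card E : ℕ) : ℕ∞) < ENat.card (ZMod p) := by
    rw [ENat.card_eq_coe_fintype_card, ZMod.card]
    exact_mod_cast hp
  obtain ⟨φ, f, h⟩ := G.exists_isGenericEncoding hlt (ZMod p) hF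
  refine h.achievable hlt R fun i k hik => ?_
  fin_cases i <;> fin_cases k
  · exact absurd rfl hik
  · simp only [Fin.zero_eta, Fin.mk_one]
    omega
  · simp only [Fin.zero_eta, Fin.mk_one]
    omega
  · exact absurd rfl hik
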